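/- Let $k\ge 1$ be an integer, let $W_k=\{(x_1,\dots,x_k)\in\mathbb Z^k : x_1>x_2>\dots>x_k>0\}$, let $e_1,\dots,e_k$ be the standard unit vectors and let $\delta=(k,k-1,\dots,1)$. An oscillating walk of length $n$ in $W_k$ is a walk with $n$ steps, each of them one of $\pm e_1,\dots,\pm e_k$, all of whose points lie in $W_k$. Let $$O_k(t)=\sum_{n\ge 0} o_n\,t^n,$$ where $o_n$ is the number of oscillating walks of length $n$ in $W_k$ that start at $\delta$ and end at a point of $\{m e_1+\delta : m\ge 0\}$. For a formal power series $F=\sum f_{i_1,\dots,i_k,j}\,z_1^{i_1}\cdots z_k^{i_k}t^j$ let $\Delta F=\sum_{n\ge0} f_{n,\dots,n,n}\,t^n$ be its diagonal; the diagonal of a rational function is that of its power series expansion at the origin. Write $\overline z_i=1/z_i$. Then the rational function below has a power series expansion at the origin, and $$(-1)^{k(k-1)/2}\,t^{2k-1}\,O_k(t)=\Delta\left[\frac{t^{2k-1}\,(z_3z_4^2\cdots z_k^{k-2})\,(z_1+1)\prod_{1\le j<i\le k}(z_i-z_j)(z_iz_j-1)\cdot\prod_{2\le i\le k}(z_i^2-1)}{1-t\,(z_1\cdots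 z_k)\,(z_1+\overline z_1+\cdots+z_k+\overline z_k)}\right].$$ -/

import Mathlib

/-! ### Oscillating walks in the Weyl chamber `x₁ > x₂ > ⋯ > x_k > 0`

Coordinates are indexed by `Fin k`, so the usual index `i ∈ {1, …, k}` is `i.val + 1`. -/

/-- The region `W_k = {(x₁, …, x_k) ∈ ℤ^k : x₁ > x₂ > ⋯ > x_k > 0}`. -/
def weylChamber (k : ℕ) : Set (Fin k → ℤ) :=
  {x | StrictAnti x ∧ ∀ i, 0 < x i}

/-- The starting point `δ = (k, k - 1, …, 1)`. -/
def deltaPoint (k : ℕ) : Fin k → ℤ := fun i => (k : ℤ) - (i.val : ℤ)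

/-- The step `e_i` (encoded by `(i, true)`) or `-e_i` (encoded by `(i, false)`). -/
def oscStep {k : ℕ} (s : Fin k × Bool) : Fin k → ℤ :=
  Pi.single s.1 (if s.2 then 1 else -1)

/-- The point reached after the first `j` steps of a walk that starts at `δ` and has the
step sequence `w`. -/
def oscPosition {k n : ℕ} (w : Fin n → Fin k × Bool) (j : ℕ) : Fin k → ℤ :=
  deltaPoint k + ∑ i : Fin n with i.val < j, oscStep (w i)

/-- The oscillating walks of length `n` in `W_k` (given by their step sequences) that start
at `δ` and end at a point of `{m e₁ + δ : m ≥ 0}`. -/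
def oscWalks (k : ℕ) [NeZero k] (n : ℕ) : Set (Fin n → Fin k × Bool) :=
  {w | (∀ j ≤ n, oscPosition w j ∈ weylChamber k) ∧
    ∃ m : ℕ, oscPosition w n = Pi.single (0 : Fin k) (m : ℤ) + deltaPoint k}

/-- The ordinary generating function `O_k(t)` of these walks, by length. -/
noncomputable def oscGF (k : ℕ) [NeZero k] : PowerSeries ℚ :=
  PowerSeries.mk fun n => ((oscWalks k n).ncard : ℚ)

/-! ### Diagonals of rational functions

The variables `z₁, …, z_k, t` are indexed by `Option (Fin k)`: `some i` for the `z`'s and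
`none` for `t`. -/

/-- The field `ℚ(z₁, …, z_k, t)`. -/
abbrev RatFun (k : ℕ) : Type := FractionRing (MvPolynomial (Option (Fin k)) ℚ)

/-- `f` is the power series expansion at the origin of the rational function `R`: one can
write `R = p / q` with polynomials `p, q` such that `q(0) ≠ 0` and `q * f = p`. -/
def IsExpansion {k : ℕ} (R : RatFun k) (f : MvPowerSeries (Option (Fin k)) ℚ) : Prop :=
  ∃ p q : MvPolynomial (Option (Fin k)) ℚ, MvPolynomial.constantCoeff q ≠ 0 ∧
    R = algebraMap _ (RatFun k) p / algebraMap _ (RatFun k) q ∧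
    (q : MvPowerSeries (Option (Fin k)) ℚ) * f = (p : MvPowerSeries (Option (Fin k)) ℚ)

/-- A rational function has at most one expansion. -/
theorem IsExpansion.unique {k : ℕ} {R : RatFun k} {f g : MvPowerSeries (Option (Fin k)) ℚ}
    (hf : IsExpansion R f) (hg : IsExpansion R g) : f = g := by
  obtain ⟨p, q, hq, hR, h⟩ := hf
  obtain ⟨p', q', hq', hR', h'⟩ := hg
  have hq0 : q ≠ 0 := by rintro rfl; simp at hq
  have hq0' : q' ≠ 0 := by rintro rfl; simp at hq'
  have inj := IsFractionRing.injective (MvPolynomial (Option (Fin k)) ℚ) (RatFun k)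
  have e : p * q' = p' * q := by
    apply inj
    rw [map_mul, map_mul]
    rw [hR, div_eq_div_iff] at hR'
    · exact hR'
    · simpa using hq0
    · simpa using hq0'
  have e' : (p : MvPowerSeries (Option (Fin k)) ℚ) * q' = p' * q := by
    exact_mod_cast congrArg (fun r : MvPolynomial (Option (Fin k)) ℚ =>
      (r : MvPowerSeries (Option (Fin k)) ℚ)) e
  have n1 : (q : MvPowerSeries (Option (Fin k)) ℚ) ≠ 0 := by simpa using hq0
  have n2 : (q' : MvPowerSeries (Option (Fin k)) ℚ) ≠ 0 := by simpa using hq0'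
  apply mul_left_cancel₀ (mul_ne_zero n1 n2)
  linear_combination (q' : MvPowerSeries (Option (Fin k)) ℚ) * h -
    (q : MvPowerSeries (Option (Fin k)) ℚ) * h' + e'

/-- The (complete) diagonal operator: `Δ ∑ f_{i₁,…,i_k,j} z₁^{i₁} ⋯ z_k^{i_k} t^j` is
`∑ f_{n,…,n,n} t^n`. -/
noncomputable def diagonal {k : ℕ} (f : MvPowerSeries (Option (Fin k)) ℚ) : PowerSeries ℚ :=
  PowerSeries.mk fun n => MvPowerSeries.coeff (Finsupp.equivFunOnFinite.symm fun _ => n) f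

/-- `g = Δ R`: the rational function `R` has a power series expansion, with diagonal `g`. -/
def IsDiagonalOf {k : ℕ} (g : PowerSeries ℚ) (R : RatFun k) : Prop :=
  ∃ f, IsExpansion R f ∧ g = diagonal f

/-- The variable `z_{i+1}` as a rational function. -/
noncomputable def zVar {k : ℕ} (i : Fin k) : RatFun k :=
  algebraMap (MvPolynomial (Option (Fin k)) ℚ) (RatFun k) (MvPolynomial.X (some i))

/-- The variable `t` as a rational function. -/
noncomputable def tVar (k : ℕ) : RatFun k :=
  algebraMap (MvPolynomial (Option (Fin k)) ℚ) (RatFun k) (MvPolynomial.X none)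

/-- The rational function
`t^{2k-1} (z₃ z₄² ⋯ z_k^{k-2}) (z₁ + 1) ∏_{j<i} (z_i - z_j)(z_i z_j - 1) ∏_{i≥2} (z_i² - 1)`
divided by `1 - t (z₁ ⋯ z_k) (z₁ + z₁⁻¹ + ⋯ + z_k + z_k⁻¹)`. -/
noncomputable def oscRational (k : ℕ) [NeZero k] : RatFun k :=
  (tVar k ^ (2 * k - 1)
      * (∏ i : Fin k with 2 ≤ i.val, zVar i ^ (i.val - 1))
      * (zVar (0 : Fin k) + 1)
      * (∏ i : Fin k, ∏ j : Fin k with j < i, (zVar i - zVar j) * (zVar i * zVar j - 1))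
      * ∏ i : Fin k with 1 ≤ i.val, (zVar i ^ 2 - 1))
    / (1 - tVar k * (∏ i : Fin k, zVar i) * ∑ i : Fin k, (zVar i + (zVar i)⁻¹))

/-!
Multiply the alternating Laurent polynomial
`D = ∏ᵢ (zᵢ - zᵢ⁻¹) · ∏_{j<i} (zᵢ + zᵢ⁻¹ - zⱼ - zⱼ⁻¹)` by `Sⁿ`, where `S = ∑ᵢ (zᵢ + zᵢ⁻¹)`. The
coefficients of the product change sign under the reflections of the Weyl group, so they vanish at
every point one step outside the chamber, since a reflection fixes it. Inside the chamber `D` has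
the single monomial `z ^ δ`, with coefficient `(-1) ^ (k (k - 1) / 2)`, because `D` is a determinant
of odd Laurent polynomials in one variable each. Hence, up to this sign, the coefficient of `D Sⁿ`
at a chamber point `x` is the number of walks of length `n` from `δ` to `x`.

Summing these coefficients over the ray `m e₁ + δ` telescopes the factor `z₁ - z₁⁻¹` of `D` to
`z₁ + 1`, leaving one coefficient, at `δ`. Clearing denominators by powers of `z₁ ⋯ z_k` turns it
into a diagonal coefficient of a power series `t ^ (2k - 1) P / (1 - t Q)` with polynomials `P`
and `Q`.
-/

/-! ### The reflection principle -/

section ReflectionPrinciple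

variable {G S R : Type*}

/-- A function that changes sign under every map in `r`. -/
def IsAlternating [Neg R] (r : Set (G → G)) (f : G → R) : Prop :=
  ∀ ρ ∈ r, ∀ x, f (ρ x) = -f x

theorem IsAlternating.eq_zero_of_fixed {r : Set (G → G)} [AddCommGroup R]
    [IsAddTorsionFree R] {f : G → R} (hf : IsAlternating r f) {ρ : G → G} (hρ : ρ ∈ r)
    {x : G} (hx : ρ x = x) : f x = 0 :=
  self_eq_neg.mp ((congrArg f hx).symm.trans (hf ρ hρ x))

variable [AddCommGroup G]

/-- The point reached after the first `j` steps of a walk that starts at `a`; the entries of `w`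
name steps through the map `step`, so `oscPosition` is the case `step = oscStep`, `a = δ`. -/
def walkPosition (step : S → G) (a : G) {n : ℕ} (w : Fin n → S) (j : ℕ) : G :=
  a + ∑ i : Fin n with i.val < j, step (w i)

/-- The walks of length `n` from `a` to `x`, given by their step sequences, all of whose points
lie in `C`. -/
def walksIn (step : S → G) (C : Set G) (a : G) (n : ℕ) (x : G) : Set (Fin n → S) :=
  {w | (∀ j ≤ n, walkPosition step a w j ∈ C) ∧ walkPosition step a w n = x}

/-- A set `r` of maps of `G` makes the region `C` reflectable for the given steps, in the sense of
Gessel and Zeilberger: the maps in `r` permute the steps, and every point that is one step outside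
`C` is fixed by a map in `r`. Steps are subtracted because walks are traced back from their ends. -/
structure IsReflectable (step : S → G) (C : Set G) (r : Set (G → G)) : Prop where
  exists_perm : ∀ ρ ∈ r, ∃ e : Equiv.Perm S, ∀ x s, ρ (x - step s) = ρ x - step (e s)
  exists_fixed : ∀ x ∈ C, ∀ s, x - step s ∉ C → ∃ ρ ∈ r, ρ (x - step s) = x - step s

variable {step : S → G} {C : Set G} {r : Set (G → G)} {a x : G} {n : ℕ}

theorem walkPosition_zero (w : Fin n → S) : walkPosition step a w 0 = a := by
  simp [walkPosition]

theorem walkPosition_snoc_of_le (w : Fin n → S) (s : S) {j : ℕ} (hj : j ≤ n) :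
    walkPosition step a (Fin.snoc w s : Fin (n + 1) → S) j = walkPosition step a w j := by
  simp [walkPosition, Finset.sum_filter, Fin.sum_univ_castSucc, hj.not_gt]

theorem walkPosition_snoc_last (w : Fin n → S) (s : S) :
    walkPosition step a (Fin.snoc w s : Fin (n + 1) → S) (n + 1) =
      walkPosition step a w n + step s := by
  simp [walkPosition, Finset.sum_filter, Fin.sum_univ_castSucc, add_assoc, Fin.is_lt]

theorem walksIn_eq_empty (hx : x ∉ C) : walksIn step C a n x = ∅ :=
  Set.eq_empty_of_forall_notMem fun _ hw => hx (hw.2 ▸ hw.1 n le_rfl)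

theorem ncard_walksIn_zero [DecidableEq G] (hx : x ∈ C) :
    (walksIn step C a 0 x).ncard = if x = a then 1 else 0 := by
  split_ifs with h
  · subst h
    have : walksIn step C x 0 x = Set.univ := by
      simp [walksIn, walkPosition_zero, hx]
    simp [this]
  · simp [walksIn, walkPosition_zero, Ne.symm h]

theorem snoc_mem_walksIn (hx : x ∈ C) (w : Fin n → S) (s : S) :
    (Fin.snoc w s : Fin (n + 1) → S) ∈ walksIn step C a (n + 1) x ↔
      w ∈ walksIn step C a n (x - step s) := by
  simp only [walksIn, Set.mem_ofPred_eq, walkPosition_snoc_last, eq_sub_iff_add_eq]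
  refine and_congr_left fun hend => ⟨fun h j hj => ?_, fun h j hj => ?_⟩
  · rw [← walkPosition_snoc_of_le w s hj]
    exact h j (hj.trans n.le_succ)
  · obtain hj | rfl := Nat.le_succ_iff.mp hj
    · rw [walkPosition_snoc_of_le w s hj]
      exact h j hj
    · rwa [walkPosition_snoc_last, hend]

theorem ncard_walksIn_succ [Fintype S] (hx : x ∈ C) :
    (walksIn step C a (n + 1) x).ncard = ∑ s, (walksIn step C a n (x - step s)).ncard := by
  classical
  have hsnoc : (Fin.snocEquiv fun _ => S) ⁻¹' walksIn step C a (n + 1) x =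
      ⋃ s, Prod.mk s '' walksIn step C a n (x - step s) := by
    ext ⟨s, w⟩
    simp [Fin.snocEquiv, snoc_mem_walksIn hx]
  rw [← Set.ncard_preimage_of_injective_subset_range (Fin.snocEquiv fun _ => S).injective
    (by simp), hsnoc, Set.ncard_iUnion_of_finite (fun _ => Set.toFinite _),
    finsum_eq_sum_of_fintype]
  · simp only [Set.ncard_image_of_injective _ (Prod.mk_right_injective _)]
  · intro s t hst
    rw [Function.onFun, Set.disjoint_left]
    rintro _ ⟨w, -, rfl⟩ ⟨v, -, hv⟩
    exact hst (congrArg Prod.fst hv).symm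

theorem IsAlternating.sum_sub_step [Fintype S] [AddCommGroup R] {f : G → R}
    (hf : IsAlternating r f) (hstep : IsReflectable step C r) :
    IsAlternating r fun x => ∑ s, f (x - step s) := by
  intro ρ hρ x
  obtain ⟨e, he⟩ := hstep.exists_perm ρ hρ
  simp only
  rw [← Equiv.sum_comp e, ← Finset.sum_neg_distrib]
  exact Finset.sum_congr rfl fun s _ => by rw [← he, hf ρ hρ]

/-- The generating Laurent polynomial `∑ₛ z ^ step s` of the steps. -/
noncomputable def stepSum (R : Type*) [Semiring R] [Fintype S] (step : S → G) :
    AddMonoidAlgebra R G :=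
  ∑ s, AddMonoidAlgebra.single (step s) 1

theorem coeff_mul_stepSum [Semiring R] [Fintype S] (f : AddMonoidAlgebra R G) (x : G) :
    (f * stepSum R step).coeff x = ∑ s, f.coeff (x - step s) := by
  simp [stepSum, Finset.mul_sum, AddMonoidAlgebra.coeff_sum, sub_eq_add_neg]

theorem IsAlternating.coeff_mul_stepSum_pow [Fintype S] [Ring R] {f : AddMonoidAlgebra R G}
    (hf : IsAlternating r f.coeff) (hstep : IsReflectable step C r) (n : ℕ) :
    IsAlternating r (f * stepSum R step ^ n).coeff := by
  induction n with
  | zero => simpa using hf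
  | succ n ih =>
    intro ρ hρ x
    simpa only [pow_succ, ← mul_assoc, coeff_mul_stepSum] using ih.sum_sub_step hstep ρ hρ x

/-- Both sides obey the recurrence that removes the last step: the walks from outside `C` that the
algebraic side would count start at a fixed point of a reflection, where an alternating function
vanishes. -/
theorem coeff_mul_stepSum_pow_eq_ncard_walksIn [Fintype S] [DecidableEq G] [Ring R]
    [IsAddTorsionFree R] {f : AddMonoidAlgebra R G} {ε : R} (hf : IsAlternating r f.coeff)
    (hstep : IsReflectable step C r) (hf₀ : ∀ x ∈ C, f.coeff x = if x = a then ε else 0)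
    (n : ℕ) (hx : x ∈ C) :
    (f * stepSum R step ^ n).coeff x = ε * (walksIn step C a n x).ncard := by
  induction n generalizing x with
  | zero => simp [hf₀ x hx, ncard_walksIn_zero hx]
  | succ n ih =>
    rw [pow_succ, ← mul_assoc, coeff_mul_stepSum, ncard_walksIn_succ hx, Nat.cast_sum,
      Finset.mul_sum]
    refine Finset.sum_congr rfl fun s _ => ?_
    by_cases hs : x - step s ∈ C
    · exact ih hs
    · obtain ⟨ρ, hρ, hfix⟩ := hstep.exists_fixed x hx s hs
      rw [(hf.coeff_mul_stepSum_pow hstep n).eq_zero_of_fixed hρ hfix, walksIn_eq_empty hs]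
      simp

end ReflectionPrinciple

/-! ### Reflections of the type `C` Weyl chamber -/

section WeylChamber

variable {k : ℕ}

/-- The transpositions and the sign changes of the coordinates, which generate the Weyl group of
type `C_k`. -/
def coordReflections (k : ℕ) : Set ((Fin k → ℤ) → Fin k → ℤ) :=
  {ρ | ∃ i j, i ≠ j ∧ ρ = (· ∘ Equiv.swap i j)} ∪ Set.range fun i x => Function.update x i (-x i)

/-- The permutation of the steps induced by the sign change of coordinate `i`. -/
def flipStep (i : Fin k) (s : Fin k × Bool) : Fin k × Bool :=
  (s.1, if s.1 = i then !s.2 else s.2)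

theorem flipStep_involutive (i : Fin k) : Function.Involutive (flipStep i) := by
  rintro ⟨l, b⟩
  by_cases h : l = i <;> simp [flipStep, h]

theorem sub_oscStep_comp_swap (i j : Fin k) (x : Fin k → ℤ) (s : Fin k × Bool) :
    (x - oscStep s) ∘ Equiv.swap i j =
      x ∘ Equiv.swap i j - oscStep ((Equiv.swap i j).prodCongr (Equiv.refl Bool) s) := by
  ext l
  simp [oscStep, Pi.single_apply, Equiv.swap_apply_eq_iff]

theorem update_neg_sub_oscStep (i : Fin k) (x : Fin k → ℤ) (s : Fin k × Bool) :
    Function.update (x - oscStep s) i (-(x - oscStep s) i) =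
      Function.update x i (-x i) - oscStep (flipStep i s) := by
  obtain ⟨a, b⟩ := s
  ext l
  by_cases hl : l = i <;> by_cases ha : a = i <;> cases b <;>
    simp [oscStep, flipStep, Pi.single_apply, hl, ha] <;> grind

theorem exists_eq_or_eq_zero_of_sub_oscStep_notMem {x : Fin k → ℤ} (hx : x ∈ weylChamber k)
    {s : Fin k × Bool} (hs : x - oscStep s ∉ weylChamber k) :
    (∃ i j, i ≠ j ∧ (x - oscStep s) i = (x - oscStep s) j) ∨ ∃ i, (x - oscStep s) i = 0 := by
  have hle : ∀ i, |oscStep s i| ≤ 1 := fun i => by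
    obtain ⟨l, b⟩ := s
    cases b <;> simp only [oscStep, Pi.single_apply] <;> split_ifs <;> simp
  have hzero : ∀ i, s.1 ≠ i → oscStep s i = 0 := fun i hi => Pi.single_eq_of_ne hi.symm _
  simp only [weylChamber, Set.mem_ofPred_eq, not_and_or, StrictAnti, not_forall, not_lt,
    Pi.sub_apply] at hs ⊢
  obtain ⟨i, j, hij, hle'⟩ | ⟨i, hi⟩ := hs
  · have := hx.1 hij
    grind
  · have := hx.2 i
    grind

theorem isReflectable_weylChamber :
    IsReflectable oscStep (weylChamber k) (coordReflections k) where
  exists_perm := by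
    rintro _ (⟨i, j, -, rfl⟩ | ⟨i, rfl⟩)
    · exact ⟨_, sub_oscStep_comp_swap i j⟩
    · exact ⟨(flipStep_involutive i).toPerm, update_neg_sub_oscStep i⟩
  exists_fixed x hx s hs := by
    obtain ⟨i, j, hij, h⟩ | ⟨i, h⟩ := exists_eq_or_eq_zero_of_sub_oscStep_notMem hx hs
    · refine ⟨_, .inl ⟨i, j, hij, rfl⟩, ?_⟩
      ext l
      simp only [Function.comp_apply, Equiv.swap_apply_def]
      grind
    · refine ⟨_, .inr ⟨i, rfl⟩, ?_⟩
      simp only [h, neg_zero, Function.update_eq_self_iff]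

theorem deltaPoint_mem_weylChamber (k : ℕ) : deltaPoint k ∈ weylChamber k :=
  ⟨fun i j hij => by simpa [deltaPoint] using hij, fun i => by simp [deltaPoint]⟩

theorem antitone_sub_deltaPoint {x : Fin k → ℤ} (hx : StrictAnti x) :
    Antitone (x - deltaPoint k) := by
  obtain - | n := k
  · exact Subsingleton.antitone _
  · refine Fin.antitone_iff_succ_le.mpr fun i => ?_
    have := hx i.castSucc_lt_succ
    simp only [deltaPoint, Pi.sub_apply, Fin.val_succ, Fin.val_castSucc]
    lia

theorem exists_lt_apply_of_ne_deltaPoint {x : Fin k → ℤ} (hx : x ∈ weylChamber k)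
    (hne : x ≠ deltaPoint k) : ∃ i, (k : ℤ) < x i := by
  obtain ⟨i, hi⟩ := Function.ne_iff.mp hne
  obtain - | n := k
  · exact i.elim0
  · have hanti := antitone_sub_deltaPoint hx.1
    have hfirst := hanti (Fin.zero_le i)
    have hlast := hanti (Fin.le_last i)
    have hpos := hx.2 (Fin.last n)
    simp only [deltaPoint, Pi.sub_apply, Fin.val_zero, Fin.val_last] at hi hfirst hlast
    exact ⟨0, by lia⟩

theorem single_add_deltaPoint_mem_weylChamber [NeZero k] (m : ℕ) :
    Pi.single (0 : Fin k) (m : ℤ) + deltaPoint k ∈ weylChamber k := by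
  obtain ⟨hanti, hpos⟩ := deltaPoint_mem_weylChamber k
  have hnonneg : (0 : Fin k → ℤ) ≤ Pi.single 0 (m : ℤ) := Pi.single_nonneg.mpr m.cast_nonneg
  refine ⟨fun i j hij => ?_, fun i => Int.add_pos_of_nonneg_of_pos (hnonneg i) (hpos i)⟩
  have hj : j ≠ 0 := ((Fin.zero_le i).trans_lt hij).ne'
  simpa [hj] using Int.add_lt_add_of_le_of_lt (hnonneg i) (hanti hij)

end WeylChamber

/-! ### The type `C` Weyl denominator as a determinant of Laurent polynomials -/

section OddLaurent

open LaurentPolynomial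

variable {R : Type*} [CommRing R]

/-- The Laurent polynomial `(T - T⁻¹) (T + T⁻¹)^j`, which is odd under `T ↦ T⁻¹`. These are the
entries of a determinant for the Weyl denominator. -/
noncomputable def oddLaurent (R : Type*) [CommRing R] (j : ℕ) : R[T;T⁻¹] :=
  (T 1 - T (-1)) * (T 1 + T (-1)) ^ j

theorem coeff_oddLaurent_neg (j : ℕ) (n : ℤ) :
    (oddLaurent R j).coeff (-n) = -(oddLaurent R j).coeff n := by
  have hodd : invert (oddLaurent R j) = -oddLaurent R j := by
    simp only [oddLaurent, map_mul, map_sub, map_pow, map_add, invert_T, neg_neg]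
    ring
  rw [← invert_apply, hodd, AddMonoidAlgebra.coeff_neg, Finsupp.neg_apply]

theorem coeff_oddLaurent_zero (n : ℤ) :
    (oddLaurent R 0).coeff n = (if n = 1 then 1 else 0) - if n = -1 then 1 else 0 := by
  simp [oddLaurent, T, Finsupp.single_apply, eq_comm, -single_eq_C_mul_T]

theorem coeff_oddLaurent_succ (j : ℕ) (n : ℤ) :
    (oddLaurent R (j + 1)).coeff n =
      (oddLaurent R j).coeff (n - 1) + (oddLaurent R j).coeff (n + 1) := by
  simp [oddLaurent, pow_succ, ← mul_assoc, mul_add, T, sub_eq_add_neg, -single_eq_C_mul_T]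

theorem coeff_oddLaurent_of_lt {j : ℕ} {n : ℤ} (hn : (j : ℤ) + 1 < n) :
    (oddLaurent R j).coeff n = 0 := by
  induction j generalizing n with
  | zero => rw [coeff_oddLaurent_zero, if_neg (by lia), if_neg (by lia), sub_zero]
  | succ j ih => rw [coeff_oddLaurent_succ, ih (by lia), ih (by lia), add_zero]

theorem coeff_oddLaurent_self (j : ℕ) : (oddLaurent R j).coeff ((j : ℤ) + 1) = 1 := by
  induction j with
  | zero => simp [coeff_oddLaurent_zero]
  | succ j ih =>
    rw [coeff_oddLaurent_succ, coeff_oddLaurent_of_lt (n := _ + 1) (by lia), add_zero,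
      Nat.cast_succ, add_sub_cancel_right, ih]

end OddLaurent

/-- Laurent polynomials in the variables `σ`, given by their coefficients on `σ → ℤ`. For infinite
`σ` this ring also contains monomials in infinitely many variables. -/
abbrev MvLaurent (σ R : Type*) [Semiring R] : Type _ := AddMonoidAlgebra R (σ → ℤ)

namespace MvLaurent

variable {σ R : Type*} [DecidableEq σ]

section CommSemiring

variable [CommSemiring R]

/-- The `i`-th variable. -/
noncomputable def var (R : Type*) [CommSemiring R] (i : σ) : MvLaurent σ R :=
  AddMonoidAlgebra.single (Pi.single i 1) 1

/-- The inverse of the `i`-th variable. -/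
noncomputable def varInv (R : Type*) [CommSemiring R] (i : σ) : MvLaurent σ R :=
  AddMonoidAlgebra.single (Pi.single i (-1)) 1

theorem var_mul_varInv (i : σ) : var R i * varInv R i = 1 := by
  rw [var, varInv, AddMonoidAlgebra.single_mul_single, ← Pi.single_add]
  simp [AddMonoidAlgebra.one_def]

/-- The inclusion of the Laurent polynomials in the `i`-th variable. -/
noncomputable def embed (R : Type*) [CommSemiring R] (i : σ) :
    LaurentPolynomial R →+* MvLaurent σ R :=
  AddMonoidAlgebra.mapDomainRingHom R (AddMonoidHom.single (fun _ : σ => ℤ) i)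

theorem embed_single (i : σ) (n : ℤ) (a : R) :
    embed R i (AddMonoidAlgebra.single n a) = AddMonoidAlgebra.single (Pi.single i n) a := by
  simp [embed, -LaurentPolynomial.single_eq_C_mul_T]

theorem coeff_prod_embed [Fintype σ] (g : σ → LaurentPolynomial R) (x : σ → ℤ) :
    (∏ i, embed R i (g i)).coeff x = ∏ i, (g i).coeff (x i) := by
  have hexpand (i : σ) : embed R i (g i) =
      ∑ n ∈ (g i).coeff.support, AddMonoidAlgebra.single (Pi.single i n) ((g i).coeff n) := by
    conv_lhs => rw [← AddMonoidAlgebra.sum_coeff_single (g i), Finsupp.sum, map_sum]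
    simp only [embed_single]
  simp_rw [hexpand]
  rw [Finset.prod_univ_sum, AddMonoidAlgebra.coeff_sum, Finsupp.finsetSum_apply]
  simp_rw [AddMonoidAlgebra.prod_single, Finset.univ_sum_single, AddMonoidAlgebra.coeff_single,
    Finsupp.single_apply]
  rw [Finset.sum_ite_eq', ite_eq_left_iff]
  intro hx
  obtain ⟨i, hi⟩ := not_forall.mp (mt Fintype.mem_piFinset.mpr hx)
  rw [Finsupp.notMem_support_iff] at hi
  exact (Finset.prod_eq_zero (Finset.mem_univ i) hi).symm

theorem stepSum_oscStep (k : ℕ) :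
    stepSum R (oscStep (k := k)) = ∑ i, (var R i + varInv R i) := by
  simp [stepSum, Fintype.sum_prod_type, oscStep, var, varInv]

end CommSemiring

variable [CommRing R]

theorem embed_oddLaurent (i : σ) (j : ℕ) :
    embed R i (oddLaurent R j) = (var R i - varInv R i) * (var R i + varInv R i) ^ j := by
  simp only [oddLaurent, LaurentPolynomial.T, map_mul, map_sub, map_pow, map_add, embed_single,
    var, varInv]

theorem coeff_det_embed [Fintype σ] (g : σ → σ → LaurentPolynomial R) (x : σ → ℤ) :
    (Matrix.of fun i j => embed R i (g i j)).det.coeff x =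
      (Matrix.of fun i j => (g i j).coeff (x i)).det := by
  rw [← Matrix.det_transpose, ← Matrix.det_transpose (Matrix.of _), Matrix.det_apply,
    Matrix.det_apply, AddMonoidAlgebra.coeff_sum, Finsupp.finsetSum_apply]
  refine Finset.sum_congr rfl fun τ _ => ?_
  rw [AddMonoidAlgebra.coeff_smul_apply]
  exact congrArg _ (coeff_prod_embed _ x)

end MvLaurent

section WeylDenom

variable {k : ℕ} {A R : Type*} [CommRing A] [CommRing R]

/-- The Weyl denominator of type `C_k`, up to sign, as a function of the variables `x i` and their
inverses `y i`. -/
def weylDenom (x y : Fin k → A) : A :=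
  (∏ i, (x i - y i)) * (Matrix.vandermonde fun i => x i + y i).det

/-- The Weyl denominator without its factor `x 0 - y 0`. -/
def weylDenomTail (x y : Fin k → A) : A :=
  (∏ i : Fin k with 1 ≤ i.val, (x i - y i)) * (Matrix.vandermonde fun i => x i + y i).det

theorem weylDenom_eq_mul_tail [NeZero k] (x y : Fin k → A) :
    weylDenom x y = (x 0 - y 0) * weylDenomTail x y := by
  have hfilter : ({i : Fin k | 1 ≤ i.val} : Finset (Fin k)) = Finset.univ.erase 0 := by
    ext i
    simp [Nat.one_le_iff_ne_zero]
  rw [weylDenom, weylDenomTail, hfilter, ← mul_assoc,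
    Finset.mul_prod_erase _ (fun i => x i - y i) (Finset.mem_univ _)]

open MvLaurent

theorem coeff_weylDenom (x : Fin k → ℤ) :
    (weylDenom (var R) (varInv R)).coeff x =
      (Matrix.of fun i j : Fin k => (oddLaurent R j).coeff (x i)).det := by
  rw [← coeff_det_embed fun _ j : Fin k => oddLaurent R j, weylDenom, ← Matrix.det_mul_column]
  simp only [embed_oddLaurent, Matrix.vandermonde_apply]

theorem isAlternating_coeff_weylDenom :
    IsAlternating (coordReflections k) (weylDenom (var R) (varInv R)).coeff := by
  rintro _ (⟨i, j, hij, rfl⟩ | ⟨i, rfl⟩) x <;> simp only [coeff_weylDenom]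
  · refine (Matrix.det_permute (Equiv.swap i j)
      (Matrix.of fun i j : Fin k => (oddLaurent R j).coeff (x i))).trans ?_
    simp [Equiv.Perm.sign_swap hij]
  · set M := Matrix.of fun i j : Fin k => (oddLaurent R j).coeff (x i) with hM
    have hrow : (Matrix.of fun a j : Fin k =>
        (oddLaurent R j).coeff (Function.update x i (-x i) a)) =
          M.updateRow i ((-1 : R) • M i) := by
      ext a j
      by_cases ha : a = i
      · subst ha
        simp [hM, coeff_oddLaurent_neg]
      · simp [hM, ha]
    rw [hrow, Matrix.det_updateRow_smul, Matrix.updateRow_eq_self, neg_one_mul]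

theorem sign_revPerm (k : ℕ) :
    Equiv.Perm.sign (Fin.revPerm : Equiv.Perm (Fin k)) = (-1) ^ (k * (k - 1) / 2) := by
  have hinv (j : Fin k) : ∏ i ∈ Finset.Iio j,
      (if (Fin.revPerm i : Fin k) < Fin.revPerm j then 1 else -1 : ℤˣ) = (-1) ^ j.val := by
    rw [← Fin.card_Iio]
    exact Finset.prod_eq_pow_card fun i hi =>
      if_neg (by simpa using (Finset.mem_Iio.mp hi).le)
  simp only [Equiv.Perm.sign_eq_prod_prod_Iio, hinv]
  rw [Finset.prod_pow_eq_pow_sum, Fin.sum_univ_eq_sum_range (fun i => i), Finset.sum_range_id]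

/-- Reversing the order of the rows makes the matrix unitriangular. -/
theorem det_coeff_oddLaurent_deltaPoint (k : ℕ) :
    (Matrix.of fun i j : Fin k => (oddLaurent R j).coeff (deltaPoint k i)).det =
      (-1) ^ (k * (k - 1) / 2) := by
  set M := Matrix.of fun i j : Fin k => (oddLaurent R j).coeff (deltaPoint k i) with hM
  have hδ (i : Fin k) : deltaPoint k i.rev = (i : ℤ) + 1 := by
    simp only [deltaPoint, Fin.val_rev]
    have := i.is_lt
    lia
  have hrev : (M.submatrix Fin.revPerm id).det = 1 := by
    rw [Matrix.det_of_isUpperTriangular]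
    · exact Finset.prod_eq_one fun i _ => by simp [hM, hδ, coeff_oddLaurent_self]
    · intro i j (hij : j.val < i.val)
      simp only [hM, Matrix.submatrix_apply, Fin.revPerm_apply, id_eq, Matrix.of_apply, hδ]
      exact coeff_oddLaurent_of_lt (by lia)
  have hsq : ((-1 : R) ^ (k * (k - 1) / 2)) * (-1) ^ (k * (k - 1) / 2) = 1 := by
    rw [← mul_pow, neg_one_mul, neg_neg, one_pow]
  rw [Matrix.det_permute, sign_revPerm] at hrev
  push_cast at hrev
  calc
    M.det = (-1) ^ (k * (k - 1) / 2) * ((-1) ^ (k * (k - 1) / 2) * M.det) := by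
      rw [← mul_assoc, hsq, one_mul]
    _ = (-1) ^ (k * (k - 1) / 2) := by rw [hrev, mul_one]

theorem coeff_weylDenom_of_mem {x : Fin k → ℤ} (hx : x ∈ weylChamber k) :
    (weylDenom (var R) (varInv R)).coeff x =
      if x = deltaPoint k then (-1) ^ (k * (k - 1) / 2) else 0 := by
  rw [coeff_weylDenom]
  split_ifs with h
  · rw [h, det_coeff_oddLaurent_deltaPoint]
  · obtain ⟨i, hi⟩ := exists_lt_apply_of_ne_deltaPoint hx h
    exact Matrix.det_eq_zero_of_row_eq_zero i fun j => coeff_oddLaurent_of_lt (by omega)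

theorem coeff_weylDenom_mul_stepSum_pow [IsAddTorsionFree R] (n : ℕ) {x : Fin k → ℤ}
    (hx : x ∈ weylChamber k) :
    (weylDenom (var R) (varInv R) * stepSum R oscStep ^ n).coeff x =
      (-1) ^ (k * (k - 1) / 2) *
        ((walksIn oscStep (weylChamber k) (deltaPoint k) n x).ncard : R) :=
  coeff_mul_stepSum_pow_eq_ncard_walksIn isAlternating_coeff_weylDenom isReflectable_weylChamber
    (fun _ => coeff_weylDenom_of_mem) n hx

end WeylDenom

/-! ### Summation along a ray -/

section Ray

variable {G R : Type*} [AddCommGroup G]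

theorem eventually_coeff_nsmul_add_eq_zero [IsAddTorsionFree G] [Semiring R]
    (f : AddMonoidAlgebra R G) {v : G} (hv : v ≠ 0) (x : G) :
    ∀ᶠ m : ℕ in Filter.atTop, f.coeff (m • v + x) = 0 := by
  have hinj : Function.Injective fun m : ℕ => m • v + x :=
    (add_left_injective x).comp (injective_nsmul_iff_not_isOfFinAddOrder.mpr
      (not_isOfFinAddOrder_of_isAddTorsionFree hv))
  have hmem := hinj.tendsto_cofinite.eventually
    f.coeff.support.finite_toSet.eventually_cofinite_notMem
  rw [Nat.cofinite_eq_atTop] at hmem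
  filter_upwards [hmem] with m hm
  simpa using hm

variable [Ring R]

open AddMonoidAlgebra in
theorem sum_range_coeff_single_sub_single_neg_mul (f : AddMonoidAlgebra R G) (v x : G) (N : ℕ) :
    ∑ m ∈ Finset.range N, ((single v 1 - single (-v) 1) * f).coeff (m • v + x) =
      ((single v 1 + 1) * f).coeff x - f.coeff (N • v + (x - v)) - f.coeff (N • v + x) := by
  induction N with
  | zero => simp [add_mul, neg_add_eq_sub]
  | succ N ih =>
    have hshift : v + (N • v + x) = (N + 1) • v + x := by rw [succ_nsmul]; abel
    have hshift' : -v + (N • v + x) = N • v + (x - v) := by abel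
    have hshift'' : (N + 1) • v + (x - v) = N • v + x := by rw [succ_nsmul]; abel
    rw [Finset.sum_range_succ, ih, hshift'']
    simp only [sub_mul, coeff_sub, Finsupp.sub_apply, coeff_single_mul_apply, one_mul, neg_neg,
      hshift, hshift']
    abel

open AddMonoidAlgebra in
/-- Multiplication by `z ^ v - z ^ (-v)` makes the coefficients along the ray telescope. -/
theorem eventually_sum_range_coeff_eq [IsAddTorsionFree G] (f : AddMonoidAlgebra R G) {v : G}
    (hv : v ≠ 0) (x : G) :
    ∀ᶠ N : ℕ in Filter.atTop,
      ∑ m ∈ Finset.range N, ((single v 1 - single (-v) 1) * f).coeff (m • v + x) =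
        ((single v 1 + 1) * f).coeff x := by
  filter_upwards [eventually_coeff_nsmul_add_eq_zero f hv x,
    eventually_coeff_nsmul_add_eq_zero f hv (x - v)] with N hN hN'
  rw [sum_range_coeff_single_sub_single_neg_mul, hN, hN', sub_zero, sub_zero]

theorem eventually_ncard_setOf_exists_eq_sum {α β : Type*} [Finite α] (s : Set α) (f : α → β)
    {p : ℕ → β} (hp : Function.Injective p) :
    ∀ᶠ N in Filter.atTop,
      {w | w ∈ s ∧ ∃ m, f w = p m}.ncard =
        ∑ m ∈ Finset.range N, {w | w ∈ s ∧ f w = p m}.ncard := by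
  have hfin : (p ⁻¹' Set.range f).Finite := (Set.finite_range f).preimage hp.injOn
  obtain ⟨b, hb⟩ := hfin.bddAbove
  filter_upwards [Filter.eventually_gt_atTop b] with N hN
  have hunion : {w | w ∈ s ∧ ∃ m, f w = p m} =
      ⋃ m ∈ (Finset.range N : Set ℕ), {w | w ∈ s ∧ f w = p m} := by
    ext w
    simp only [Set.mem_iUnion, Set.mem_ofPred_eq, Finset.coe_range, Set.mem_Iio, exists_prop]
    constructor
    · rintro ⟨hw, m, hm⟩
      exact ⟨m, (hb ⟨w, hm⟩).trans_lt hN, hw, hm⟩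
    · rintro ⟨m, -, hw, hm⟩
      exact ⟨hw, m, hm⟩
  have hdisj : Pairwise (Function.onFun Disjoint fun m => {w | w ∈ s ∧ f w = p m}) :=
    fun m m' hne => Set.disjoint_left.mpr fun w hw hw' => hne (hp (hw.2.symm.trans hw'.2))
  rw [hunion, Set.Finite.ncard_biUnion (Finset.range N).finite_toSet (fun _ _ => Set.toFinite _)
    (hdisj.set_pairwise _), finsum_mem_coe_finset]

end Ray

/-! ### The diagonal of `t ^ a * P / (1 - t * Q)` -/

section Diagonal

theorem one_sub_X_mul_C_mul_mk_pow {R : Type*} [CommRing R] (q : R) :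
    (1 - PowerSeries.X * PowerSeries.C q) * PowerSeries.mk (q ^ ·) = 1 := by
  have h := congrArg (PowerSeries.rescale q) (PowerSeries.mk_one_mul_one_sub_eq_one R)
  simpa [PowerSeries.rescale_mk, PowerSeries.rescale_X, mul_comm] using h

theorem optionEquivLeft_coe_rename_some {σ R : Type*} [CommSemiring R] (P : MvPolynomial σ R) :
    MvPowerSeries.optionEquivLeft σ R
        (MvPolynomial.rename some P : MvPolynomial (Option σ) R) =
      PowerSeries.C (P : MvPowerSeries σ R) := by
  induction P using MvPolynomial.induction_on with
  | C a => simp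
  | add p q hp hq => simp [hp, hq]
  | mul_X p i hp => simp [hp]

theorem isDiagonalOf_div_one_sub {k : ℕ} (P Q : MvPolynomial (Fin k) ℚ) (a : ℕ) :
    IsDiagonalOf
      (PowerSeries.X ^ a * PowerSeries.mk fun n =>
        (P * Q ^ n).coeff (Finsupp.equivFunOnFinite.symm fun _ => n + a))
      (algebraMap _ (RatFun k) (MvPolynomial.X none ^ a * MvPolynomial.rename some P) /
        algebraMap _ (RatFun k) (1 - MvPolynomial.X none * MvPolynomial.rename some Q)) := by
  let e := MvPowerSeries.optionEquivLeft (Fin k) ℚ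
  let F : PowerSeries (MvPowerSeries (Fin k) ℚ) :=
    PowerSeries.X ^ a * (PowerSeries.C (P : MvPowerSeries (Fin k) ℚ) *
      PowerSeries.mk ((Q : MvPowerSeries (Fin k) ℚ) ^ ·))
  have he : e (e.symm F) = F := e.apply_symm_apply F
  refine ⟨e.symm F, ⟨_, _, by simp, rfl, e.injective ?_⟩, ?_⟩
  · have hsub (p q : MvPolynomial (Option (Fin k)) ℚ) :
        ((p - q : MvPolynomial (Option (Fin k)) ℚ) : MvPowerSeries (Option (Fin k)) ℚ) = p - q :=
      map_sub MvPolynomial.coeToMvPowerSeries.ringHom p q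
    simp only [map_mul, he, hsub, MvPolynomial.coe_mul, MvPolynomial.coe_pow, MvPolynomial.coe_X,
      MvPolynomial.coe_one, map_sub, map_one, map_pow, e,
      MvPowerSeries.optionEquivLeft_X_none, optionEquivLeft_coe_rename_some]
    linear_combination (PowerSeries.X ^ a * PowerSeries.C (P : MvPowerSeries (Fin k) ℚ)) *
      one_sub_X_mul_C_mul_mk_pow (Q : MvPowerSeries (Fin k) ℚ)
  · ext n
    have hconst : (Finsupp.equivFunOnFinite.symm fun _ : Option (Fin k) => n) =
        (Finsupp.equivFunOnFinite.symm fun _ : Fin k => n).optionElim n := by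
      ext i
      cases i <;> simp
    rw [diagonal, PowerSeries.coeff_mk, hconst, ← MvPowerSeries.coeff_coeff_optionEquivLeft, he,
      PowerSeries.coeff_X_pow_mul', PowerSeries.coeff_X_pow_mul']
    split_ifs with hn
    · rw [PowerSeries.coeff_mk, PowerSeries.coeff_C_mul, PowerSeries.coeff_mk,
        Nat.sub_add_cancel hn, ← MvPolynomial.coe_pow, ← MvPolynomial.coe_mul,
        MvPolynomial.coeff_coe]
    · rw [map_zero]

end Diagonal

/-! ### The numerator and the denominator -/

section Numerator

variable {k : ℕ} {A : Type*}

/-- The numerator of `oscRational`, without its power of `t`, as a function of the values `x i` of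
the variables. -/
def oscNumerator [CommRing A] [NeZero k] (x : Fin k → A) : A :=
  (∏ i : Fin k with 2 ≤ i.val, x i ^ (i.val - 1))
    * (x 0 + 1)
    * (∏ i : Fin k, ∏ j : Fin k with j < i, (x i - x j) * (x i * x j - 1))
    * ∏ i : Fin k with 1 ≤ i.val, (x i ^ 2 - 1)

/-- The sum of the variables `x i` and their inverses, multiplied by the product of the `x i`. -/
def stepNumerator [CommSemiring A] {ι : Type*} [Fintype ι] [DecidableEq ι] (x : ι → A) : A :=
  ∑ i, (x i ^ 2 + 1) * ∏ j ∈ Finset.univ.erase i, x j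

theorem map_oscNumerator {B F : Type*} [CommRing A] [CommRing B] [FunLike F A B]
    [RingHomClass F A B] [NeZero k] (f : F) (x : Fin k → A) :
    f (oscNumerator x) = oscNumerator fun i => f (x i) := by
  simp only [oscNumerator, map_mul, map_prod, map_pow, map_add, map_sub, map_one]

theorem map_stepNumerator {B F ι : Type*} [CommSemiring A] [CommSemiring B] [FunLike F A B]
    [RingHomClass F A B] [Fintype ι] [DecidableEq ι] (f : F) (x : ι → A) :
    f (stepNumerator x) = stepNumerator fun i => f (x i) := by
  simp only [stepNumerator, map_sum, map_mul, map_prod, map_pow, map_add, map_one]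

theorem prod_mul_sum_add_eq_stepNumerator [CommSemiring A] {ι : Type*} [Fintype ι] [DecidableEq ι]
    {x y : ι → A} (hxy : ∀ i, x i * y i = 1) :
    (∏ i, x i) * ∑ i, (x i + y i) = stepNumerator x := by
  rw [stepNumerator, Finset.mul_sum]
  refine Finset.sum_congr rfl fun i _ => ?_
  rw [← Finset.mul_prod_erase Finset.univ x (Finset.mem_univ i), mul_right_comm, mul_add, hxy, sq]

theorem prod_prod_lt_mul [CommMonoid A] (x : Fin k → A) :
    ∏ i, ∏ j with j < i, (x i * x j) = (∏ i, x i) ^ (k - 1) := by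
  have hright : ∏ i : Fin k, ∏ j with j < i, x j = ∏ j : Fin k, x j ^ (k - 1 - j.val) := by
    rw [Finset.prod_comm' (t' := Finset.univ) (s' := fun j => Finset.Ioi j) (by simp)]
    simp only [Finset.prod_const, Fin.card_Ioi]
  simp only [Finset.prod_mul_distrib, Finset.prod_const]
  rw [hright, ← Finset.prod_mul_distrib, ← Finset.prod_pow]
  refine Finset.prod_congr rfl fun i _ => ?_
  rw [Finset.filter_gt_eq_Iio, Fin.card_Iio, ← pow_add,
    Nat.add_sub_cancel' (Nat.le_sub_one_of_lt i.is_lt)]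

theorem prod_pow_sub_one_mul_prod [CommMonoid A] (x : Fin k → A) :
    (∏ i : Fin k with 2 ≤ i.val, x i ^ (i.val - 1)) * (∏ i : Fin k with 1 ≤ i.val, x i) =
      ∏ i, x i ^ i.val := by
  rw [Finset.prod_filter, Finset.prod_filter, ← Finset.prod_mul_distrib]
  refine Finset.prod_congr rfl fun i _ => ?_
  obtain ⟨_ | _ | n, hi⟩ := i <;> simp [pow_succ]

theorem prod_pow_sub_mul_oscNumerator [CommRing A] [NeZero k] {x y : Fin k → A}
    (hxy : ∀ i, x i * y i = 1) :
    (∏ i, x i ^ (k - i.val)) * oscNumerator x =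
      (∏ i, x i) ^ (2 * k - 1) * ((x 0 + 1) * weylDenomTail x y) := by
  have hpairs : ∏ i : Fin k, ∏ j with j < i, ((x i - x j) * (x i * x j - 1)) =
      (∏ i, x i) ^ (k - 1) * (Matrix.vandermonde fun i => x i + y i).det := by
    have hdet : (Matrix.vandermonde fun i => x i + y i).det =
        ∏ i : Fin k, ∏ j with j < i, (x i + y i - (x j + y j)) :=
      (Matrix.det_vandermonde _).trans (Finset.prod_comm' (by simp))
    rw [← prod_prod_lt_mul, hdet]
    simp only [← Finset.prod_mul_distrib]
    refine Finset.prod_congr rfl fun i _ => Finset.prod_congr rfl fun j _ => ?_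
    linear_combination x i * hxy j - x j * hxy i
  have hsquares : ∏ i : Fin k with 1 ≤ i.val, (x i ^ 2 - 1) =
      (∏ i : Fin k with 1 ≤ i.val, x i) * ∏ i : Fin k with 1 ≤ i.val, (x i - y i) := by
    rw [← Finset.prod_mul_distrib]
    refine Finset.prod_congr rfl fun i _ => ?_
    linear_combination hxy i
  have hpow : (∏ i, x i ^ (k - i.val)) * (∏ i, x i ^ i.val) = (∏ i, x i) ^ k := by
    rw [← Finset.prod_mul_distrib, ← Finset.prod_pow]
    refine Finset.prod_congr rfl fun i _ => ?_
    rw [← pow_add, Nat.sub_add_cancel i.is_lt.le]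
  have hk : 2 * k - 1 = k + (k - 1) := by
    have := Nat.pos_of_neZero k
    lia
  rw [oscNumerator, hpairs, hsquares, hk, pow_add, ← hpow, ← prod_pow_sub_one_mul_prod,
    weylDenomTail]
  ring

theorem oscRational_eq_div (k : ℕ) [NeZero k] :
    oscRational k =
      algebraMap (MvPolynomial (Option (Fin k)) ℚ) (RatFun k) (MvPolynomial.X none ^ (2 * k - 1) *
          MvPolynomial.rename some (oscNumerator MvPolynomial.X)) /
        algebraMap (MvPolynomial (Option (Fin k)) ℚ) (RatFun k) (1 - MvPolynomial.X none *
          MvPolynomial.rename some (stepNumerator MvPolynomial.X)) := by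
  have hz (i : Fin k) : zVar i * (zVar i)⁻¹ = 1 := by
    refine mul_inv_cancel₀ ?_
    rw [zVar, Ne, FaithfulSMul.algebraMap_eq_zero_iff]
    exact MvPolynomial.X_ne_zero _
  rw [oscRational, mul_assoc (tVar k), prod_mul_sum_add_eq_stepNumerator hz]
  simp only [map_mul, map_sub, map_one, map_pow, map_oscNumerator, map_stepNumerator,
    MvPolynomial.rename_X]
  simp only [oscNumerator, tVar, zVar, mul_assoc]
  rfl

end Numerator

/-! ### Coefficients of the numerator as numbers of walks -/

namespace MvLaurent

variable {σ R : Type*} [DecidableEq σ] [CommSemiring R]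

theorem prod_var_pow [Fintype σ] (d : σ → ℕ) :
    ∏ i, var R i ^ d i = AddMonoidAlgebra.single (fun i => (d i : ℤ)) 1 := by
  simp_rw [var, AddMonoidAlgebra.single_pow, one_pow, AddMonoidAlgebra.prod_single,
    Finset.prod_const_one, ← Pi.single_smul, nsmul_one, Finset.univ_sum_single]

theorem coeff_aeval_var [Finite σ] (F : MvPolynomial σ R) (d : σ →₀ ℕ) :
    (MvPolynomial.aeval (var R) F).coeff (fun i => (d i : ℤ)) = F.coeff d := by
  have := Fintype.ofFinite σ
  induction F using MvPolynomial.induction_on' with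
  | monomial e a =>
    have hexp : ((fun i => (e i : ℤ)) = fun i => (d i : ℤ)) ↔ e = d := by
      simp [funext_iff, Finsupp.ext_iff]
    rw [MvPolynomial.aeval_monomial, Finsupp.prod_fintype _ _ (by simp), prod_var_pow,
      ← Algebra.smul_def, AddMonoidAlgebra.coeff_smul_apply, AddMonoidAlgebra.coeff_single,
      Finsupp.single_apply, MvPolynomial.coeff_monomial]
    simp [hexp]
  | add p q hp hq => simp [hp, hq]

end MvLaurent

section WalkCount

open MvLaurent

variable {k : ℕ} [NeZero k] {R : Type*} [CommRing R]

theorem coeff_oscNumerator_mul_stepNumerator_pow (n : ℕ) :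
    (oscNumerator MvPolynomial.X * stepNumerator MvPolynomial.X ^ n : MvPolynomial (Fin k) R).coeff
        (Finsupp.equivFunOnFinite.symm fun _ => n + (2 * k - 1)) =
      ((var R 0 + 1) * (weylDenomTail (var R) (varInv R) * stepSum R oscStep ^ n)).coeff
        (deltaPoint k) := by
  set H := (var R (0 : Fin k) + 1) * (weylDenomTail (var R) (varInv R) * stepSum R oscStep ^ n)
  set P : MvPolynomial (Fin k) R := oscNumerator MvPolynomial.X * stepNumerator MvPolynomial.X ^ n
    with hP
  let v : Fin k → ℤ := fun _ => ((n + (2 * k - 1) : ℕ) : ℤ)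
  have hδ : ∏ i : Fin k, var R i ^ (k - i.val) = AddMonoidAlgebra.single (deltaPoint k) 1 := by
    rw [prod_var_pow]
    congr 1
    ext i
    exact Nat.cast_sub i.is_lt.le
  have hprod : (∏ i : Fin k, var R i) ^ (n + (2 * k - 1)) = AddMonoidAlgebra.single v 1 := by
    rw [← Finset.prod_pow, prod_var_pow]
  have hshift : AddMonoidAlgebra.single (deltaPoint k) 1 * MvPolynomial.aeval (var R) P =
      AddMonoidAlgebra.single v 1 * H := by
    rw [hP, map_mul, map_pow, map_oscNumerator, map_stepNumerator]
    simp only [MvPolynomial.aeval_X]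
    rw [← mul_assoc, ← hδ, prod_pow_sub_mul_oscNumerator (var_mul_varInv (R := R)),
      ← prod_mul_sum_add_eq_stepNumerator (var_mul_varInv (R := R)), ← stepSum_oscStep, ← hprod]
    ring
  have hcoeff := congrArg (fun f => f.coeff (v + deltaPoint k)) hshift
  simp only [AddMonoidAlgebra.coeff_single_mul_apply, one_mul, neg_add_cancel_left,
    neg_add_cancel_comm_assoc] at hcoeff
  rw [← coeff_aeval_var, ← hcoeff]
  rfl

theorem coeff_oscNumerator_mul_stepNumerator_pow_eq_ncard [IsAddTorsionFree R] (n : ℕ) :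
    (oscNumerator MvPolynomial.X * stepNumerator MvPolynomial.X ^ n : MvPolynomial (Fin k) R).coeff
        (Finsupp.equivFunOnFinite.symm fun _ => n + (2 * k - 1)) =
      (-1) ^ (k * (k - 1) / 2) * ((oscWalks k n).ncard : R) := by
  set H := weylDenomTail (var R) (varInv R) * stepSum R (oscStep (k := k)) ^ n
  let e : Fin k → ℤ := Pi.single 0 1
  have he : e ≠ 0 := by simp [e]
  have hsmul (m : ℕ) : m • e = Pi.single 0 (m : ℤ) := by simp [e, ← Pi.single_smul]
  have hpoint : Function.Injective fun m : ℕ => Pi.single (0 : Fin k) (m : ℤ) + deltaPoint k :=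
    (add_left_injective _).comp ((Pi.single_injective 0).comp Nat.cast_injective)
  have hdenom : weylDenom (var R) (varInv R) * stepSum R oscStep ^ n =
      (AddMonoidAlgebra.single e 1 - AddMonoidAlgebra.single (-e) 1) * H := by
    rw [weylDenom_eq_mul_tail, mul_assoc, var, varInv, Pi.single_neg]
  obtain ⟨N, hwalks, htelescope⟩ := ((eventually_ncard_setOf_exists_eq_sum
    {w | ∀ j ≤ n, oscPosition w j ∈ weylChamber k} (oscPosition · n) hpoint).and
      (eventually_sum_range_coeff_eq H he (deltaPoint k))).exists
  calc
    _ = ((var R 0 + 1) * H).coeff (deltaPoint k) := coeff_oscNumerator_mul_stepNumerator_pow n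
    _ = ∑ m ∈ Finset.range N, (weylDenom (var R) (varInv R) * stepSum R oscStep ^ n).coeff
          (Pi.single 0 (m : ℤ) + deltaPoint k) := by
      simp only [hdenom, ← hsmul, htelescope]
      rfl
    _ = ∑ m ∈ Finset.range N, (-1) ^ (k * (k - 1) / 2) * ((walksIn oscStep (weylChamber k)
          (deltaPoint k) n (Pi.single 0 (m : ℤ) + deltaPoint k)).ncard : R) :=
      Finset.sum_congr rfl fun m _ =>
        coeff_weylDenom_mul_stepSum_pow n (single_add_deltaPoint_mem_weylChamber m)
    _ = (-1) ^ (k * (k - 1) / 2) * ((oscWalks k n).ncard : R) := by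
      rw [← Finset.mul_sum, ← Nat.cast_sum]
      exact congrArg (fun c : ℕ => (-1) ^ (k * (k - 1) / 2) * (c : R)) hwalks.symm

end WalkCount

theorem mainTheorem4 (k : ℕ) [NeZero k] :
    IsDiagonalOf
      ((-1) ^ (k * (k - 1) / 2) * (PowerSeries.X ^ (2 * k - 1) * oscGF k))
      (oscRational k) := by
  rw [oscRational_eq_div, mul_left_comm]
  convert isDiagonalOf_div_one_sub (oscNumerator MvPolynomial.X) (stepNumerator MvPolynomial.X)
    (2 * k - 1)
  have hsign : ((-1) ^ (k * (k - 1) / 2) : PowerSeries ℚ) =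
      PowerSeries.C ((-1) ^ (k * (k - 1) / 2)) := by simp
  ext n
  rw [hsign, PowerSeries.coeff_C_mul, oscGF, PowerSeries.coeff_mk, PowerSeries.coeff_mk,
    coeff_oscNumerator_mul_stepNumerator_pow_eq_ncard]
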